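/- A cell is a unit square $[x,x+1]\times[y,y+1]$ with $x,y\in\mathbb Z$. A polyomino is a finite connected union of cells having no cut point (equivalently, for the hole-free case used here, a finite nonempty set of cells that is connected through common edges), considered up to translation; it is convex if the intersection with each row and with each column of cells is connected. Let $n\ge 1$ and let $P$ be a polyomino without holes that has exactly $n$ rows and $n$ columns, placed so that the south-west corner of its minimal bounding rectangle is $(1,1)$. Let $A_1,A_2,\ldots,A_{2(r+1)}$ be the vertices (corners of the boundary) of $P$ listed in clockwise order, where $A_1$ is the leftmost of the lowest vertices. Then $P$ is a permutomino of size $n+1$ if $\{A_1,A_3,\ldots,A_{2r+1}\}=\{(i,\pi_1(i)) : 1\le i\le n+1\}$ and $\{A_2,A_4,\ldots,A_{2r+2}\}=\{(i,\pi_2(i)) : 1\le i\le n+1\}$ for two permutations $\pi_1=\pi_1(P)$ and $\pi_2=\pi_2(P)$ of $\{1,\ldots,n+1\}$. By convention there is also one (empty, convex) permutomino of size $1$, whose permutations are the identity of $\{1\}$. For $m\ge 1$ let $\mathcal C_m$ be the set of convex permutominoes of size $m$, let $\widetilde{\mathcal C}_m=\{\pi_1(P) : P\in\mathcal C_m\}$,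 and for a permutation $\pi$ of $\{1,\ldots,m\}$ let $[\pi]=\{P\in\mathcal C_m : \pi_1(P)=\pi\}$. Proposition. Let $m\ge 1$ and let $\pi\in\widetilde{\mathcal C}_m$ with $\pi(1)>\pi(m)$. Then there is exactly one convex permutomino associated with $\pi$, i.e. $|[\pi]|=1$. -/

import Mathlib

/-!
Cells are unit squares of the plane; the pair `(x, y)` of integers stands for the cell
`[x, x + 1] × [y, y + 1]`, so `(x, y)` is its south-west corner.
-/

namespace Permutomino

/-- Two cells are adjacent when they share an edge. -/
def cellGraph : SimpleGraph (ℤ × ℤ) where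
  Adj c d := |c.1 - d.1| + |c.2 - d.2| = 1
  symm := ⟨fun c d h => by rw [abs_sub_comm d.1, abs_sub_comm d.2]; exact h⟩
  loopless := ⟨fun c h => by simp at h⟩

/-- A polyomino: a finite nonempty set of cells that is connected through edges
(so that its union has no cut point). -/
def IsPolyomino (P : Finset (ℤ × ℤ)) : Prop :=
  (cellGraph.induce (P : Set (ℤ × ℤ))).Connected

/-- No holes: the complement of the (closed) union of the cells is connected. That complement is
open, so it is connected exactly when the cells outside `P` are connected through edges. -/
def WithoutHoles (P : Finset (ℤ × ℤ)) : Prop :=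
  (cellGraph.induce (P : Set (ℤ × ℤ))ᶜ).Connected

/-- Every column is connected. -/
def IsColumnConvex (P : Finset (ℤ × ℤ)) : Prop :=
  ∀ x : ℤ, {y : ℤ | (x, y) ∈ P}.OrdConnected

/-- Every row is connected. -/
def IsRowConvex (P : Finset (ℤ × ℤ)) : Prop :=
  ∀ y : ℤ, {x : ℤ | (x, y) ∈ P}.OrdConnected

/-- Convex: both row and column convex. -/
def IsConvex (P : Finset (ℤ × ℤ)) : Prop :=
  IsRowConvex P ∧ IsColumnConvex P

/-- `P` has exactly `n` columns and `n` rows, and the south-west corner of its minimal bounding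
rectangle is `(1, 1)`. This picks one representative of each class of translates. -/
def IsPlacedInSquare (n : ℕ) (P : Finset (ℤ × ℤ)) : Prop :=
  P.image Prod.fst = Finset.Icc 1 (n : ℤ) ∧ P.image Prod.snd = Finset.Icc 1 (n : ℤ)

/-- The four unit steps of lattice paths. -/
inductive Step where
  | north
  | east
  | south
  | west

/-- The displacement of a step. -/
def Step.vec : Step → ℤ × ℤ
  | .north => (0, 1)
  | .east => (1, 0)
  | .south => (0, -1)
  | .west => (-1, 0)

/-- The cell to the right of the unit step `s` that starts at the lattice point `p`. -/
def Step.rightCell (s : Step) (p : ℤ × ℤ) : ℤ × ℤ :=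
  match s with
  | .north => (p.1, p.2)
  | .east => (p.1, p.2 - 1)
  | .south => (p.1 - 1, p.2 - 1)
  | .west => (p.1 - 1, p.2)

/-- The cell to the left of the unit step `s` that starts at the lattice point `p`. -/
def Step.leftCell (s : Step) (p : ℤ × ℤ) : ℤ × ℤ :=
  match s with
  | .north => (p.1 - 1, p.2)
  | .east => (p.1, p.2)
  | .south => (p.1, p.2 - 1)
  | .west => (p.1 - 1, p.2 - 1)

/-- The unit step `s` from `p` runs along the boundary of `P` in the clockwise sense, that is,
with `P` on its right and the outside on its left. -/
def IsBoundaryStep (P : Finset (ℤ × ℤ)) (p : ℤ × ℤ) (s : Step) : Prop :=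
  s.rightCell p ∈ P ∧ s.leftCell p ∉ P

/-- A vertex of `P`, that is, a corner of its boundary: a boundary step arrives at `p` and a
boundary step with a different direction leaves from `p`. -/
def IsVertex (P : Finset (ℤ × ℤ)) (p : ℤ × ℤ) : Prop :=
  ∃ s t : Step, s ≠ t ∧ IsBoundaryStep P (p - s.vec) s ∧ IsBoundaryStep P p t

/-- A straight, nondegenerate piece of the boundary leads from `p` to `q` in the clockwise
sense. -/
def IsSide (P : Finset (ℤ × ℤ)) (p q : ℤ × ℤ) : Prop :=
  ∃ (s : Step) (k : ℕ), 0 < k ∧ q = p + k • s.vec ∧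
    ∀ j < k, IsBoundaryStep P (p + j • s.vec) s

/-- `A 0, A 1, …, A (2 r + 1)` is the list of the vertices of `P`, each once, in the clockwise
order along the boundary, starting from the leftmost of the lowest vertices. Addition in
`Fin (2 * r + 2)` is cyclic, so the last vertex is joined to the first one. -/
structure IsClockwiseVertexList (P : Finset (ℤ × ℤ)) (r : ℕ)
    (A : Fin (2 * r + 2) → ℤ × ℤ) : Prop where
  injective : Function.Injective A
  mem_range_iff : ∀ p, p ∈ Set.range A ↔ IsVertex P p
  side : ∀ i, IsSide P (A i) (A (i + 1))
  start : ∀ p, IsVertex P p → (A 0).2 < p.2 ∨ ((A 0).2 = p.2 ∧ (A 0).1 ≤ p.1)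

/-- The points `(i, π(i))`, `1 ≤ i ≤ N`, of a permutation `π` of `{1, …, N}`; the element `i` of
`Fin N` stands for the number `i + 1`. -/
def permPoints {N : ℕ} (π : Equiv.Perm (Fin N)) : Set (ℤ × ℤ) :=
  Set.range fun i : Fin N => ((i : ℤ) + 1, (π i : ℤ) + 1)

/-- `P` is a permutomino of size `n + 1` with `π₁(P) = π₁` and `π₂(P) = π₂`: it is a polyomino
without holes, with `n ≥ 1` rows and columns, and the first, third, … (respectively the second,
fourth, …) vertices are the points of `π₁` (respectively `π₂`); counted from zero, they have even
(respectively odd) indices. By convention there is also the empty permutomino, of size `1`,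
associated with the only permutation of one element. -/
def IsPermutominoWith {n : ℕ} (P : Finset (ℤ × ℤ)) (π₁ π₂ : Equiv.Perm (Fin (n + 1))) : Prop :=
  (n = 0 ∧ P = ∅) ∨
  (1 ≤ n ∧ IsPolyomino P ∧ WithoutHoles P ∧ IsPlacedInSquare n P ∧
    ∃ (r : ℕ) (A : Fin (2 * r + 2) → ℤ × ℤ), IsClockwiseVertexList P r A ∧
      A '' {i | Even (i : ℕ)} = permPoints π₁ ∧ A '' {i | Odd (i : ℕ)} = permPoints π₂)

/-- The set of convex permutominoes of size `n + 1`. -/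
def convexPermutominoes (n : ℕ) : Set (Finset (ℤ × ℤ)) :=
  {P | IsConvex P ∧ ∃ π₁ π₂ : Equiv.Perm (Fin (n + 1)), IsPermutominoWith P π₁ π₂}

/-- `π = π₁(P)`, for a permutomino `P` of size `n + 1`. -/
def IsPi₁ {n : ℕ} (P : Finset (ℤ × ℤ)) (π : Equiv.Perm (Fin (n + 1))) : Prop :=
  ∃ π₂ : Equiv.Perm (Fin (n + 1)), IsPermutominoWith P π π₂

/-- The set of the permutations `π₁(P)`, where `P` is a convex permutomino of size `n + 1`. -/
def convexPermutations (n : ℕ) : Set (Equiv.Perm (Fin (n + 1))) :=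
  {π | ∃ P ∈ convexPermutominoes n, IsPi₁ P π}

/-- The set `[π]` of the convex permutominoes `P` with `π₁(P) = π`. -/
def associatedConvexPermutominoes {n : ℕ} (π : Equiv.Perm (Fin (n + 1))) :
    Set (Finset (ℤ × ℤ)) :=
  {P | P ∈ convexPermutominoes n ∧ IsPi₁ P π}

end Permutomino

/-! Existence is the hypothesis on `π`; the content is that `π` determines the cells. Write `p` for
the values of `π`. Along the clockwise boundary horizontal and vertical sides alternate, starting
vertically, so the points of `π₁` are exactly the corners where the boundary turns vertical
(`isTurnToVertical_iff_mem`): one on each grid line. Describe `P` by its lower and upper boundaries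
`l`, `u` over the columns. At an interior line `x` exactly one of them jumps: either `l x = p x`
(`l` jumps), or `u (x - 1) = p x` (`u` jumps). With `l 1 = p 1` and `u n = p (n + 1)`, knowing which
one jumps at each `x` recovers `l` from the left and `u` from the right. When `p (n + 1) < p 1`,
this choice can be read off from `p` (`lower_eq_iff`): `l` jumps at `x` iff `p x ≤ p 1` and some
later value exceeds `p x`. The reason is row convexity, which makes `l` valley-shaped and `u`
mountain-shaped (`lower_le_max`, `min_le_upper`). -/

namespace Permutomino

/-- The two horizontal steps. -/
def Step.IsHorizontal : Step → Prop
  | .north => False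
  | .east => True
  | .south => False
  | .west => True

/-- A boundary corner at which the clockwise boundary arrives horizontally and leaves
vertically. -/
def IsTurnToVertical (P : Finset (ℤ × ℤ)) (p : ℤ × ℤ) : Prop :=
  ∃ s t : Step, s.IsHorizontal ∧ ¬ t.IsHorizontal ∧
    IsBoundaryStep P (p - s.vec) s ∧ IsBoundaryStep P p t

/-- Two cells of `P` never meet in a point that is surrounded by two cells of `P` and two cells
outside, in alternation. -/
def HasNoPinch (P : Finset (ℤ × ℤ)) : Prop :=
  ∀ x y : ℤ,
    ¬ ((x, y) ∈ P ∧ (x - 1, y - 1) ∈ P ∧ (x - 1, y) ∉ P ∧ (x, y - 1) ∉ P) ∧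
    ¬ ((x, y) ∉ P ∧ (x - 1, y - 1) ∉ P ∧ (x - 1, y) ∈ P ∧ (x, y - 1) ∈ P)

/-! ### Corners of the boundary and the parity of their indices. -/

section Corners

variable {P : Finset (ℤ × ℤ)}

theorem isBoundaryStep_north {x y : ℤ} :
    IsBoundaryStep P (x, y) .north ↔ (x, y) ∈ P ∧ (x - 1, y) ∉ P := Iff.rfl

theorem isBoundaryStep_east {x y : ℤ} :
    IsBoundaryStep P (x, y) .east ↔ (x, y - 1) ∈ P ∧ (x, y) ∉ P := Iff.rfl

theorem isBoundaryStep_south {x y : ℤ} :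
    IsBoundaryStep P (x, y) .south ↔ (x - 1, y - 1) ∈ P ∧ (x, y - 1) ∉ P := Iff.rfl

theorem isBoundaryStep_west {x y : ℤ} :
    IsBoundaryStep P (x, y) .west ↔ (x - 1, y) ∈ P ∧ (x - 1, y - 1) ∉ P := Iff.rfl

theorem isBoundaryStep_sub_north {x y : ℤ} :
    IsBoundaryStep P ((x, y) - Step.north.vec) .north ↔
      (x, y - 1) ∈ P ∧ (x - 1, y - 1) ∉ P := by
  simp [IsBoundaryStep, Step.vec, Step.rightCell, Step.leftCell]

theorem isBoundaryStep_sub_east {x y : ℤ} :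
    IsBoundaryStep P ((x, y) - Step.east.vec) .east ↔
      (x - 1, y - 1) ∈ P ∧ (x - 1, y) ∉ P := by
  simp [IsBoundaryStep, Step.vec, Step.rightCell, Step.leftCell]

theorem isBoundaryStep_sub_south {x y : ℤ} :
    IsBoundaryStep P ((x, y) - Step.south.vec) .south ↔
      (x - 1, y) ∈ P ∧ (x, y) ∉ P := by
  simp [IsBoundaryStep, Step.vec, Step.rightCell, Step.leftCell]

theorem isBoundaryStep_sub_west {x y : ℤ} :
    IsBoundaryStep P ((x, y) - Step.west.vec) .west ↔
      (x, y) ∈ P ∧ (x, y - 1) ∉ P := by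
  simp [IsBoundaryStep, Step.vec, Step.rightCell, Step.leftCell]

/-- Two different boundary steps can leave a point only if the four cells around it alternate
between `P` and its complement. -/
theorem HasNoPinch.eq_of_leave (hP : HasNoPinch P) {p : ℤ × ℤ} {s t : Step}
    (hs : IsBoundaryStep P p s) (ht : IsBoundaryStep P p t) : s = t := by
  obtain ⟨x, y⟩ := p
  have := hP x y
  cases s <;> cases t <;>
    simp only [isBoundaryStep_north, isBoundaryStep_east, isBoundaryStep_south,
      isBoundaryStep_west] at hs ht <;> first | rfl | (exfalso; tauto)

theorem HasNoPinch.eq_of_arrive (hP : HasNoPinch P) {p : ℤ × ℤ} {s t : Step}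
    (hs : IsBoundaryStep P (p - s.vec) s) (ht : IsBoundaryStep P (p - t.vec) t) : s = t := by
  obtain ⟨x, y⟩ := p
  have := hP x y
  cases s <;> cases t <;>
    simp only [isBoundaryStep_sub_north, isBoundaryStep_sub_east, isBoundaryStep_sub_south,
      isBoundaryStep_sub_west] at hs ht <;> first | rfl | (exfalso; tauto)

/-- The boundary cannot reverse: the cell on the left of the arriving step would be on the right of
the leaving one. So every turn is a right angle. -/
theorem isHorizontal_iff_not_of_turn {p : ℤ × ℤ} {s t : Step} (hst : s ≠ t)
    (hs : IsBoundaryStep P (p - s.vec) s) (ht : IsBoundaryStep P p t) :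
    s.IsHorizontal ↔ ¬ t.IsHorizontal := by
  obtain ⟨x, y⟩ := p
  cases s <;> cases t <;>
    simp only [isBoundaryStep_sub_north, isBoundaryStep_sub_east, isBoundaryStep_sub_south,
      isBoundaryStep_sub_west, isBoundaryStep_north, isBoundaryStep_east, isBoundaryStep_south,
      isBoundaryStep_west] at hs ht <;> simp only [Step.IsHorizontal] <;> tauto

theorem IsTurnToVertical.isVertex {p : ℤ × ℤ} (h : IsTurnToVertical P p) : IsVertex P p := by
  obtain ⟨s, t, hs, ht, h1, h2⟩ := h
  exact ⟨s, t, fun e => ht (e ▸ hs), h1, h2⟩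

theorem isTurnToVertical_iff {x y : ℤ} :
    IsTurnToVertical P (x, y) ↔
      ((x - 1, y - 1) ∈ P ∧ (x - 1, y) ∉ P ∨ (x, y) ∈ P ∧ (x, y - 1) ∉ P) ∧
      ((x, y) ∈ P ∧ (x - 1, y) ∉ P ∨ (x - 1, y - 1) ∈ P ∧ (x, y - 1) ∉ P) := by
  constructor
  · rintro ⟨s, t, hs, ht, h1, h2⟩
    cases s <;> cases t <;> simp only [Step.IsHorizontal, not_true_eq_false] at hs ht <;>
    simp only [isBoundaryStep_sub_east,
      isBoundaryStep_sub_west, isBoundaryStep_north, isBoundaryStep_south] at h1 h2 <;> tauto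
  · rintro ⟨h1 | h1, h2 | h2⟩
    · exact ⟨.east, .north, trivial, id, isBoundaryStep_sub_east.2 h1, isBoundaryStep_north.2 h2⟩
    · exact ⟨.east, .south, trivial, id, isBoundaryStep_sub_east.2 h1, isBoundaryStep_south.2 h2⟩
    · exact ⟨.west, .north, trivial, id, isBoundaryStep_sub_west.2 h1, isBoundaryStep_north.2 h2⟩
    · exact ⟨.west, .south, trivial, id, isBoundaryStep_sub_west.2 h1, isBoundaryStep_south.2 h2⟩

/-- Below every cell of `P`, weakly, there is a vertex of `P`. -/
theorem exists_isVertex_snd_le {c : ℤ × ℤ} (hc : c ∈ P) : ∃ p, IsVertex P p ∧ p.2 ≤ c.2 := by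
  -- The south-west corner of the leftmost lowest cell is a vertex.
  obtain ⟨d, hd, hmin⟩ := P.exists_min_image (fun d : ℤ × ℤ => toLex (d.2, d.1)) ⟨c, hc⟩
  have key : ∀ e ∈ P, d.2 < e.2 ∨ d.2 = e.2 ∧ d.1 ≤ e.1 := fun e he => by
    simpa [Prod.Lex.toLex_le_toLex] using hmin e he
  obtain ⟨x, y⟩ := d
  refine ⟨(x, y), IsTurnToVertical.isVertex (isTurnToVertical_iff.2 ?_), ?_⟩
  · have h1 : (x, y - 1) ∉ P := fun h => by have := key _ h; dsimp only at this; omega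
    have h2 : (x - 1, y) ∉ P := fun h => by have := key _ h; dsimp only at this; omega
    tauto
  · rcases key c hc with h | h
    · exact h.le
    · exact h.1.le

/-- The vertices with even index are the ones where the boundary turns vertical. -/
theorem IsClockwiseVertexList.isTurnToVertical_iff_mem (hP : HasNoPinch P) {r : ℕ}
    {A : Fin (2 * r + 2) → ℤ × ℤ} (hA : IsClockwiseVertexList P r A) (p : ℤ × ℤ) :
    IsTurnToVertical P p ↔ p ∈ A '' {i | Even (i : ℕ)} := by
  choose s k hk hq hstep using hA.side
  have leave : ∀ i, IsBoundaryStep P (A i) (s i) := fun i => by simpa using hstep i 0 (hk i)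
  have arrive : ∀ i, IsBoundaryStep P (A (i + 1) - (s i).vec) (s i) := fun i => by
    have h := hstep i (k i - 1) (Nat.sub_lt (hk i) one_pos)
    have e : A (i + 1) - (s i).vec = A i + (k i - 1) • (s i).vec := by
      obtain ⟨m, hm⟩ := Nat.exists_eq_succ_of_ne_zero (hk i).ne'
      rw [hq i, hm, Nat.succ_sub_one, Nat.succ_eq_add_one, add_smul, one_smul]
      abel
    rwa [e]
  have isV : ∀ i, IsVertex P (A i) := fun i => (hA.mem_range_iff _).1 ⟨i, rfl⟩
  have alt : ∀ i, (s i).IsHorizontal ↔ ¬ (s (i + 1)).IsHorizontal := fun i => by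
    obtain ⟨a, b, hab, ha, hb⟩ := isV (i + 1)
    rw [hP.eq_of_arrive ha (arrive i), hP.eq_of_leave hb (leave (i + 1))] at hab
    exact isHorizontal_iff_not_of_turn hab (arrive i) (leave (i + 1))
  -- Leaving east would put a cell, hence a vertex, below `A 0`; leaving west would lead to a vertex
  -- at the same height further left.
  have first : ¬ (s 0).IsHorizontal := by
    intro h0
    have hl := leave 0
    have hq0 := hq 0
    have hk0 := hk 0
    cases hs : s 0 with
    | north => rw [hs] at h0; exact h0
    | south => rw [hs] at h0; exact h0
    | east =>
      rw [hs] at hl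
      obtain ⟨q, hqv, hq2⟩ := exists_isVertex_snd_le hl.1
      have := hA.start q hqv
      simp only [Step.rightCell] at hq2
      omega
    | west =>
      have h1 := hA.start _ (isV (0 + 1))
      rw [hq0, hs] at h1
      simp [Step.vec] at h1
      omega
  have par : ∀ m (hm : m < 2 * r + 2), (s ⟨m, hm⟩).IsHorizontal ↔ Odd m := by
    intro m
    induction m with
    | zero => intro hm; simpa using first
    | succ m ih =>
      intro hm
      have e : (⟨m + 1, hm⟩ : Fin (2 * r + 2)) = ⟨m, by omega⟩ + 1 := by
        ext
        simp [Fin.val_add, Nat.mod_eq_of_lt hm]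
      rw [e, Nat.odd_add_one, ← ih (by omega), alt ⟨m, by omega⟩, not_not]
  have arrive' : ∀ i, IsBoundaryStep P (A i - (s (i - 1)).vec) (s (i - 1)) := fun i => by
    simpa using arrive (i - 1)
  have alt' : ∀ i, (s (i - 1)).IsHorizontal ↔ ¬ (s i).IsHorizontal := fun i => by
    simpa using alt (i - 1)
  constructor
  · intro h
    obtain ⟨i, rfl⟩ := (hA.mem_range_iff p).2 h.isVertex
    obtain ⟨a, b, -, hb, -, h2⟩ := h
    refine ⟨i, ?_, rfl⟩
    rw [hP.eq_of_leave h2 (leave i), par i i.2, Nat.not_odd_iff_even] at hb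
    exact hb
  · rintro ⟨i, hi, rfl⟩
    have hv : ¬ (s i).IsHorizontal := by
      rw [par i i.2, Nat.not_odd_iff_even]; exact hi
    exact ⟨s (i - 1), s i, (alt' i).2 hv, hv, arrive' i, leave i⟩

end Corners

/-! ### Columns of a convex polyomino and the shape of its boundaries. -/

section Columns

variable {P : Finset (ℤ × ℤ)}

/-- The column at `x`, for `1 ≤ x ≤ n`, consists of the cells with `l x ≤ y < u x`; all other
columns are empty, and consecutive columns overlap. -/
structure HasColumns (P : Finset (ℤ × ℤ)) (n : ℕ) (l u : ℤ → ℤ) : Prop where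
  mem_iff : ∀ x y, (x, y) ∈ P ↔ (1 ≤ x ∧ x ≤ n) ∧ l x ≤ y ∧ y < u x
  lt : ∀ x : ℤ, 1 ≤ x → x ≤ n → l x < u x
  lt_left : ∀ x : ℤ, 2 ≤ x → x ≤ n → l x < u (x - 1)
  lt_right : ∀ x : ℤ, 2 ≤ x → x ≤ n → l (x - 1) < u x

/-- A path of cells from `c` to `d` must cross the vertical line at `x`, and it does so by a
horizontal move. -/
theorem exists_mem_mem_sub_one (hP : IsPolyomino P) {c d : ℤ × ℤ} (hc : c ∈ P) (hd : d ∈ P)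
    {x : ℤ} (hcx : c.1 < x) (hdx : x ≤ d.1) : ∃ y, (x - 1, y) ∈ P ∧ (x, y) ∈ P := by
  obtain ⟨w⟩ := hP.preconnected ⟨c, hc⟩ ⟨d, hd⟩
  obtain ⟨e, -, h1, h2⟩ := w.exists_boundary_dart {v | v.1.1 < x} hcx (not_lt.2 hdx)
  obtain ⟨⟨⟨⟨a, b⟩, hab⟩, ⟨⟨a', b'⟩, hab'⟩⟩, hadj⟩ := e
  have hadj : |a - a'| + |b - b'| = 1 := hadj
  simp only [Set.mem_ofPred_eq, not_lt] at h1 h2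
  have ha : a' - a ≥ 1 := by omega
  have hb := abs_nonneg (b - b')
  have hle := neg_abs_le (a - a')
  have hb0 : |b - b'| = 0 := by omega
  have : b = b' := by rw [abs_eq_zero] at hb0; omega
  subst this
  have e1 : a = x - 1 := by omega
  have e2 : a' = x := by omega
  subst e1 e2
  exact ⟨b, hab, hab'⟩

theorem exists_hasColumns {n : ℕ} (hP : IsPolyomino P) (hcol : IsColumnConvex P)
    (hsq : IsPlacedInSquare n P) : ∃ l u, HasColumns P n l u := by
  have hne : ∀ x : ℤ, 1 ≤ x → x ≤ n → ∃ y, (x, y) ∈ P := fun x h1 h2 => by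
    have : x ∈ P.image Prod.fst := by rw [hsq.1]; exact Finset.mem_Icc.2 ⟨h1, h2⟩
    simpa using this
  have hrange : ∀ x y : ℤ, (x, y) ∈ P → 1 ≤ x ∧ x ≤ n := fun x y h => by
    have : x ∈ P.image Prod.fst := Finset.mem_image_of_mem Prod.fst h
    rw [hsq.1] at this
    exact Finset.mem_Icc.1 this
  have hint : ∀ x : ℤ, ∃ a b : ℤ, 1 ≤ x → x ≤ n →
      a < b ∧ ∀ y, (x, y) ∈ P ↔ a ≤ y ∧ y < b := by
    intro x
    by_cases hx : 1 ≤ x ∧ x ≤ n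
    · let S := (P.filter fun c => c.1 = x).image Prod.snd
      have hS : ∀ y, y ∈ S ↔ (x, y) ∈ P := fun y => by simp [S]
      have hSne : S.Nonempty := by
        obtain ⟨y, hy⟩ := hne x hx.1 hx.2
        exact ⟨y, (hS y).2 hy⟩
      -- The `+ 1` gives the height of the top edge of the column, not the row of its top cell.
      refine ⟨S.min' hSne, S.max' hSne + 1, fun _ _ => ⟨?_, fun y => ⟨fun h => ?_, fun h => ?_⟩⟩⟩
      · have := S.min'_le_max' hSne
        omega
      · have h := (hS y).2 h
        exact ⟨S.min'_le y h, Int.lt_add_one_iff.2 (S.le_max' y h)⟩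
      · exact (hcol x).out ((hS _).1 (S.min'_mem hSne)) ((hS _).1 (S.max'_mem hSne))
          ⟨h.1, Int.lt_add_one_iff.1 h.2⟩
    · exact ⟨0, 0, fun h1 h2 => absurd ⟨h1, h2⟩ hx⟩
  choose l u hlu using hint
  have hmem : ∀ x y, (x, y) ∈ P ↔ (1 ≤ x ∧ x ≤ n) ∧ l x ≤ y ∧ y < u x := fun x y =>
    ⟨fun h => ⟨hrange x y h, ((hlu x (hrange x y h).1 (hrange x y h).2).2 y).1 h⟩,
      fun h => ((hlu x h.1.1 h.1.2).2 y).2 h.2⟩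
  have hover : ∀ x : ℤ, 2 ≤ x → x ≤ n → ∃ y, (x - 1, y) ∈ P ∧ (x, y) ∈ P := fun x h1 h2 => by
    obtain ⟨y, hy⟩ := hne (x - 1) (by omega) (by omega)
    obtain ⟨z, hz⟩ := hne x (by omega) h2
    exact exists_mem_mem_sub_one hP hy hz (by simp) le_rfl
  refine ⟨l, u, hmem, fun x h1 h2 => (hlu x h1 h2).1, fun x h1 h2 => ?_, fun x h1 h2 => ?_⟩ <;>
  · obtain ⟨y, hy, hy'⟩ := hover x h1 h2
    rw [hmem] at hy hy'
    omega

namespace HasColumns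

variable {n : ℕ} {l u : ℤ → ℤ}

/-- A pinch on line `x` means that two neighbouring columns touch only in a corner, `l x = u (x -
1)` or `u x = l (x - 1)`, against their overlap. -/
theorem hasNoPinch (h : HasColumns P n l u) : HasNoPinch P := by
  intro x y
  simp only [h.mem_iff]
  by_cases hx : 2 ≤ x ∧ x ≤ n
  · have h1 := h.lt_left x hx.1 hx.2
    have h2 := h.lt_right x hx.1 hx.2
    constructor <;> intro hh <;> omega
  · constructor <;> intro hh <;> omega

/-- In a row-convex polyomino the lower boundary has no interior strict maximum. -/
theorem lower_le_max (h : HasColumns P n l u) (hrow : IsRowConvex P) {i j k : ℤ} (hi : 1 ≤ i)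
    (hij : i ≤ j) (hjk : j ≤ k) (hk : k ≤ n) : l j ≤ l i ∨ l j ≤ l k := by
  by_contra! hc
  -- Row `v` misses column `j`. But walking from `i` or from `k` towards `j`, the last column before
  -- `l` first exceeds `v` has a cell in row `v`, as it overlaps the next one. This breaks row
  -- convexity.
  let v := max (l i) (l k)
  have left : ∀ m, i ≤ m → m ≤ j → l m ≤ v ∨ ∃ z, i ≤ z ∧ z ≤ j ∧ (z, v) ∈ P := by
    intro m hm
    induction m, hm using Int.leInduction with
    | base => intro _; exact Or.inl (le_max_left _ _)
    | succ m hm ih =>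
      intro hmj
      rcases ih (by omega) with h1 | h1
      · by_cases h2 : l (m + 1) ≤ v
        · exact Or.inl h2
        · have := h.lt_left (m + 1) (by omega) (by omega)
          rw [add_sub_cancel_right] at this
          exact Or.inr ⟨m, hm, by omega, (h.mem_iff _ _).2 ⟨by omega, h1, by omega⟩⟩
      · exact Or.inr h1
  have right : ∀ m, m ≤ k → j ≤ m → l m ≤ v ∨ ∃ z, j ≤ z ∧ z ≤ k ∧ (z, v) ∈ P := by
    intro m hm
    induction m, hm using Int.leInductionDown with
    | base => intro _; exact Or.inl (le_max_right _ _)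
    | pred m hm ih =>
      intro hmj
      rcases ih (by omega) with h1 | h1
      · by_cases h2 : l (m - 1) ≤ v
        · exact Or.inl h2
        · have := h.lt_right m (by omega) (by omega)
          exact Or.inr ⟨m, by omega, hm, (h.mem_iff _ _).2 ⟨by omega, h1, by omega⟩⟩
      · exact Or.inr h1
  have hv : v < l j := max_lt hc.1 hc.2
  rcases left j hij le_rfl with h1 | ⟨z, -, hz2, hz⟩
  · omega
  rcases right j hjk le_rfl with h1 | ⟨w, hw1, -, hw⟩
  · omega
  have := (hrow v).out hz hw ⟨hz2, hw1⟩
  have := (h.mem_iff _ _).1 this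
  omega

/-- In a row-convex polyomino the upper boundary has no interior strict minimum. -/
theorem min_le_upper (h : HasColumns P n l u) (hrow : IsRowConvex P) {i j k : ℤ} (hi : 1 ≤ i)
    (hij : i ≤ j) (hjk : j ≤ k) (hk : k ≤ n) : u i ≤ u j ∨ u k ≤ u j := by
  by_contra! hc
  -- The mirror argument; `- 1` because the top cell of a column lies in row `u - 1`.
  let v := min (u i) (u k) - 1
  have left : ∀ m, i ≤ m → m ≤ j → v < u m ∨ ∃ z, i ≤ z ∧ z ≤ j ∧ (z, v) ∈ P := by
    intro m hm
    induction m, hm using Int.leInduction with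
    | base => intro _; exact Or.inl (by omega)
    | succ m hm ih =>
      intro hmj
      rcases ih (by omega) with h1 | h1
      · by_cases h2 : v < u (m + 1)
        · exact Or.inl h2
        · have := h.lt_right (m + 1) (by omega) (by omega)
          rw [add_sub_cancel_right] at this
          exact Or.inr ⟨m, hm, by omega, (h.mem_iff _ _).2 ⟨by omega, by omega, h1⟩⟩
      · exact Or.inr h1
  have right : ∀ m, m ≤ k → j ≤ m → v < u m ∨ ∃ z, j ≤ z ∧ z ≤ k ∧ (z, v) ∈ P := by
    intro m hm
    induction m, hm using Int.leInductionDown with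
    | base => intro _; exact Or.inl (by omega)
    | pred m hm ih =>
      intro hmj
      rcases ih (by omega) with h1 | h1
      · by_cases h2 : v < u (m - 1)
        · exact Or.inl h2
        · have := h.lt_left m (by omega) (by omega)
          exact Or.inr ⟨m, by omega, hm, (h.mem_iff _ _).2 ⟨by omega, by omega, h1⟩⟩
      · exact Or.inr h1
  have hv : u j ≤ v := by omega
  rcases left j hij le_rfl with h1 | ⟨z, -, hz2, hz⟩
  · omega
  rcases right j hjk le_rfl with h1 | ⟨w, hw1, -, hw⟩
  · omega
  have := (hrow v).out hz hw ⟨hz2, hw1⟩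
  have := (h.mem_iff _ _).1 this
  omega

theorem isTurnToVertical_left (h : HasColumns P n l u) (hn : 1 ≤ n) :
    IsTurnToVertical P (1, l 1) := by
  have := h.lt 1 le_rfl (by omega)
  simp only [isTurnToVertical_iff, h.mem_iff]
  omega

theorem isTurnToVertical_right (h : HasColumns P n l u) (hn : 1 ≤ n) :
    IsTurnToVertical P (n + 1, u n) := by
  have := h.lt n (by omega) le_rfl
  simp only [isTurnToVertical_iff, h.mem_iff, add_sub_cancel_right]
  omega

/-- Clockwise, the lower boundary runs west, so it reaches line `x` at the height of column `x`. -/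
theorem isTurnToVertical_lower (h : HasColumns P n l u) {x : ℤ} (h1 : 2 ≤ x) (h2 : x ≤ n)
    (hx : l x ≠ l (x - 1)) : IsTurnToVertical P (x, l x) := by
  have := h.lt x (by omega) h2
  have := h.lt_left x h1 h2
  simp only [isTurnToVertical_iff, h.mem_iff]
  omega

/-- The upper boundary runs east, so it reaches line `x` at the height of column `x - 1`. -/
theorem isTurnToVertical_upper (h : HasColumns P n l u) {x : ℤ} (h1 : 2 ≤ x) (h2 : x ≤ n)
    (hx : u x ≠ u (x - 1)) : IsTurnToVertical P (x, u (x - 1)) := by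
  have := h.lt (x - 1) (by omega) (by omega)
  have := h.lt_left x h1 h2
  simp only [isTurnToVertical_iff, h.mem_iff]
  omega

theorem not_isTurnToVertical (h : HasColumns P n l u) {x : ℤ} (h1 : 2 ≤ x) (h2 : x ≤ n)
    (hl : l x = l (x - 1)) (hu : u x = u (x - 1)) (y : ℤ) : ¬ IsTurnToVertical P (x, y) := by
  simp only [isTurnToVertical_iff, h.mem_iff]
  omega

end HasColumns

end Columns

/-! ### Reconstruction of the boundaries from the heights of the turns. -/

section Profiles

/-- The lower and upper boundaries of a convex polyomino with `n` columns such that every vertical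
grid line `x` contains exactly one corner `(x, p x)` where the clockwise boundary turns
vertical. -/
structure IsProfile (n : ℕ) (p l u : ℤ → ℤ) : Prop where
  lt : ∀ x : ℤ, 1 ≤ x → x ≤ n → l x < u x
  left : l 1 = p 1
  right : u n = p (n + 1)
  step : ∀ x : ℤ, 2 ≤ x → x ≤ n →
    (l x = p x ∧ u x = u (x - 1)) ∨ (u (x - 1) = p x ∧ l x = l (x - 1))
  lower_le_max : ∀ i j k : ℤ, 1 ≤ i → i ≤ j → j ≤ k → k ≤ n → l j ≤ l i ∨ l j ≤ l k
  min_le_upper : ∀ i j k : ℤ, 1 ≤ i → i ≤ j → j ≤ k → k ≤ n → u i ≤ u j ∨ u k ≤ u j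

/-- If neither boundary jumped at `x`, line `x` would carry no turn; if both did, it would carry
two, at the heights `l x < u (x - 1)`. -/
theorem HasColumns.isProfile {P : Finset (ℤ × ℤ)} {n : ℕ} {l u p : ℤ → ℤ}
    (h : HasColumns P n l u) (hn : 1 ≤ n) (hrow : IsRowConvex P)
    (hp : ∀ x y : ℤ, 1 ≤ x → x ≤ n + 1 → (IsTurnToVertical P (x, y) ↔ y = p x)) :
    IsProfile n p l u where
  lt := h.lt
  left := (hp _ _ le_rfl (by omega)).1 (h.isTurnToVertical_left hn)
  right := (hp _ _ (by omega) le_rfl).1 (h.isTurnToVertical_right hn)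
  step x h1 h2 := by
    have hx := hp x
    have hl := h.lt_left x h1 h2
    by_cases hlx : l x = l (x - 1)
    · by_cases hux : u x = u (x - 1)
      · exact absurd ((hx _ (by omega) (by omega)).2 rfl)
          (h.not_isTurnToVertical h1 h2 hlx hux (p x))
      · exact Or.inr ⟨(hx _ (by omega) (by omega)).1 (h.isTurnToVertical_upper h1 h2 hux), hlx⟩
    · have h3 := (hx _ (by omega) (by omega)).1 (h.isTurnToVertical_lower h1 h2 hlx)
      by_cases hux : u x = u (x - 1)
      · exact Or.inl ⟨h3, hux⟩
      · have h4 := (hx _ (by omega) (by omega)).1 (h.isTurnToVertical_upper h1 h2 hux)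
        omega
  lower_le_max _ _ _ hi hij hjk hk := h.lower_le_max hrow hi hij hjk hk
  min_le_upper _ _ _ hi hij hjk hk := h.min_le_upper hrow hi hij hjk hk

namespace IsProfile

variable {n : ℕ} {p l u l' u' : ℤ → ℤ}

/-- Every value of the upper boundary is the height of a turn further to the right. -/
theorem exists_eq_upper (h : IsProfile n p l u) {x : ℤ} (hx : x ≤ n) :
    1 ≤ x → ∃ k, x < k ∧ k ≤ n + 1 ∧ p k = u x := by
  induction x, hx using Int.leInductionDown with
  | base => exact fun _ => ⟨n + 1, by omega, le_rfl, h.right.symm⟩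
  | pred x hx ih =>
    intro h1
    rcases h.step x (by omega) hx with hs | hs
    · obtain ⟨k, hk1, hk2, hk⟩ := ih (by omega)
      exact ⟨k, by omega, hk2, by rw [hk, hs.2]⟩
    · exact ⟨x, by omega, by omega, hs.1.symm⟩

/-- The lines where the lower boundary changes can be read off from the heights of the turns. -/
theorem lower_eq_iff (h : IsProfile n p l u) (hp : p (n + 1) < p 1) {x : ℤ} (h1 : 2 ≤ x)
    (h2 : x ≤ n) :
    l x = p x ∧ u x = u (x - 1) ↔ p x ≤ p 1 ∧ ∃ k, x < k ∧ k ≤ n + 1 ∧ p x < p k := by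
  have hleft := h.left
  have hright := h.right
  have hlt1 := h.lt 1 le_rfl (by omega)
  have hltn := h.lt n (by omega) le_rfl
  have hltx := h.lt x (by omega) h2
  constructor
  · rintro ⟨hl, hu⟩
    constructor
    -- Either bound suffices: `l 1 = p 1`, and `l n < u n = p (n + 1) < p 1`. Only here does the
    -- inequality between the end values enter.
    · have := h.lower_le_max 1 x n le_rfl (by omega) h2 le_rfl
      omega
    · obtain ⟨k, hk1, hk2, hk⟩ := h.exists_eq_upper h2 (by omega)
      exact ⟨k, hk1, hk2, by omega⟩
  · rintro ⟨hx, k, hk1, hk2, hk⟩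
    -- Otherwise `u (x - 1) = p x ≤ p 1 = l 1 < u 1`, while `p k > p x` forces a column from `x` on
    -- with larger `u`: column `n`, `k` or `k - 1` according to the kind of turn at `k`. Then `u`
    -- would have a strict valley at `x - 1`.
    refine (h.step x h1 h2).resolve_right fun hs => ?_
    by_cases hkn : k = n + 1
    · have := h.min_le_upper 1 (x - 1) n le_rfl (by omega) (by omega) le_rfl
      subst hkn
      omega
    · rcases h.step k (by omega) (by omega) with hkL | hkU
      · have := h.min_le_upper 1 (x - 1) k le_rfl (by omega) (by omega) (by omega)
        have := h.lt k (by omega) (by omega)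
        omega
      · have := h.min_le_upper 1 (x - 1) (k - 1) le_rfl (by omega) (by omega) (by omega)
        omega

theorem step_and_step (h : IsProfile n p l u) (h' : IsProfile n p l' u') (hp : p (n + 1) < p 1)
    {x : ℤ} (h1 : 2 ≤ x) (h2 : x ≤ n) :
    ((l x = p x ∧ u x = u (x - 1)) ∧ (l' x = p x ∧ u' x = u' (x - 1))) ∨
    ((u (x - 1) = p x ∧ l x = l (x - 1)) ∧ (u' (x - 1) = p x ∧ l' x = l' (x - 1))) := by
  have e := (h.lower_eq_iff hp h1 h2).trans (h'.lower_eq_iff hp h1 h2).symm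
  by_cases hL : l x = p x ∧ u x = u (x - 1)
  · exact Or.inl ⟨hL, e.1 hL⟩
  · exact Or.inr ⟨(h.step x h1 h2).resolve_left hL,
      (h'.step x h1 h2).resolve_left fun hL' => hL (e.2 hL')⟩

theorem lower_unique (h : IsProfile n p l u) (h' : IsProfile n p l' u') (hp : p (n + 1) < p 1)
    {x : ℤ} (h1 : 1 ≤ x) : x ≤ n → l x = l' x := by
  induction x, h1 using Int.leInduction with
  | base => exact fun _ => h.left.trans h'.left.symm
  | succ x h1 ih =>
    intro h2
    have := ih (by omega)
    have hs := h.step_and_step h' hp (x := x + 1) (by omega) h2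
    rw [add_sub_cancel_right] at hs
    omega

/-- Induction runs from the right because a jump of `u` at `x` prescribes the value before the jump,
`u (x - 1)`. -/
theorem upper_unique (h : IsProfile n p l u) (h' : IsProfile n p l' u') (hp : p (n + 1) < p 1)
    {x : ℤ} (h2 : x ≤ n) : 1 ≤ x → u x = u' x := by
  induction x, h2 using Int.leInductionDown with
  | base => exact fun _ => h.right.trans h'.right.symm
  | pred x h2 ih =>
    intro h1
    have := ih (by omega)
    have hs := h.step_and_step h' hp (x := x) (by omega) h2
    omega

end IsProfile

end Profiles

/-! ### From permutations to profiles, and uniqueness. -/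

/-- The values of a permutation of `{1, …, n + 1}`, extended to the integers. -/
def permValue {n : ℕ} (π : Equiv.Perm (Fin (n + 1))) (x : ℤ) : ℤ :=
  (π (Fin.ofNat (n + 1) (x - 1).toNat) : ℤ) + 1

theorem mem_permPoints_iff {n : ℕ} (π : Equiv.Perm (Fin (n + 1))) {x y : ℤ} (h1 : 1 ≤ x)
    (h2 : x ≤ n + 1) : (x, y) ∈ permPoints π ↔ y = permValue π x := by
  obtain ⟨m, rfl⟩ : ∃ m : ℕ, x = m + 1 := ⟨(x - 1).toNat, by omega⟩
  have hm : m < n + 1 := by omega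
  have hv : permValue π (m + 1) = (π ⟨m, hm⟩ : ℤ) + 1 := by
    -- In this range neither `toNat` nor the reduction modulo `n + 1` changes anything.
    have : Fin.ofNat (n + 1) ((m : ℤ) + 1 - 1).toNat = ⟨m, hm⟩ := by
      ext
      simp [Nat.mod_eq_of_lt hm]
    rw [permValue, this]
  rw [hv]
  constructor
  · rintro ⟨i, hi⟩
    simp only [Prod.mk.injEq] at hi
    have : i = ⟨m, hm⟩ := by ext; simp; omega
    rw [← hi.2, this]
  · rintro rfl
    exact ⟨⟨m, hm⟩, rfl⟩

theorem permValue_last_lt_permValue_one {n : ℕ} {π : Equiv.Perm (Fin (n + 1))}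
    (h : π (Fin.last n) < π 0) : permValue π (n + 1) < permValue π 1 := by
  have e1 : permValue π (n + 1) = (π (Fin.last n) : ℤ) + 1 :=
    ((mem_permPoints_iff π (by omega) le_rfl).1 ⟨Fin.last n, by simp⟩).symm
  have e2 : permValue π 1 = (π 0 : ℤ) + 1 :=
    ((mem_permPoints_iff π le_rfl (by omega)).1 ⟨0, by simp⟩).symm
  rw [e1, e2]
  have := Fin.lt_def.1 h
  omega

theorem exists_isProfile {n : ℕ} (hn : 1 ≤ n) {π : Equiv.Perm (Fin (n + 1))}
    {P : Finset (ℤ × ℤ)} (hP : P ∈ associatedConvexPermutominoes π) :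
    ∃ l u, HasColumns P n l u ∧ IsProfile n (permValue π) l u := by
  obtain ⟨⟨hconv, -⟩, π₂, h0 | ⟨-, hpoly, -, hsq, r, A, hA, hA1, -⟩⟩ := hP
  · omega
  obtain ⟨l, u, h⟩ := exists_hasColumns hpoly hconv.2 hsq
  refine ⟨l, u, h, h.isProfile hn hconv.1 fun x y h1 h2 => ?_⟩
  rw [hA.isTurnToVertical_iff_mem h.hasNoPinch, hA1, mem_permPoints_iff π h1 h2]

theorem eq_of_mem_associatedConvexPermutominoes {n : ℕ} {π : Equiv.Perm (Fin (n + 1))}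
    (h : π (Fin.last n) < π 0) {P Q : Finset (ℤ × ℤ)}
    (hP : P ∈ associatedConvexPermutominoes π) (hQ : Q ∈ associatedConvexPermutominoes π) :
    P = Q := by
  have hn : 1 ≤ n := by
    rcases Nat.eq_zero_or_pos n with rfl | hn
    · exact absurd h (lt_irrefl _)
    · exact hn
  obtain ⟨l, u, hlu, hprof⟩ := exists_isProfile hn hP
  obtain ⟨l', u', hlu', hprof'⟩ := exists_isProfile hn hQ
  have hp := permValue_last_lt_permValue_one h
  ext ⟨x, y⟩
  rw [hlu.mem_iff, hlu'.mem_iff]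
  refine and_congr_right fun hx => ?_
  rw [hprof.lower_unique hprof' hp hx.1 hx.2, hprof.upper_unique hprof' hp hx.2 hx.1]

end Permutomino

theorem mainTheorem9 (n : ℕ) (π : Equiv.Perm (Fin (n + 1)))
    (hπ : π ∈ Permutomino.convexPermutations n) (h : π (Fin.last n) < π 0) :
    (Permutomino.associatedConvexPermutominoes π).ncard = 1 := by
  obtain ⟨P, hP, hPπ⟩ := hπ
  have hmem : P ∈ Permutomino.associatedConvexPermutominoes π := ⟨hP, hPπ⟩
  exact Set.ncard_eq_one.2 ⟨P, Set.eq_singleton_iff_unique_mem.2 ⟨hmem, fun Q hQ =>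
    Permutomino.eq_of_mem_associatedConvexPermutominoes h hQ hmem⟩⟩
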